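/- Let $m,n\ge 1$ be integers and let $k$ be a field. Let $y$ be a Vigenère ciphertext over the alphabet $\mathbb{Z}/n$ obtained from a plaintext $x=x_0x_1\cdots x_{N-1}$ with a key $K=(K_0,\dots,K_{m-1})$ of length $m$, that is, $y=y_0\cdots y_{N-1}$ with $y_j=x_j+K_{j \bmod m}$. Write $|y|=N$ for its length and $f_a$ for the number of occurrences of the letter $a$ in $y$. For $0\le i<m$ let $L_i$ be the list of the letters of $y$ in the positions $j\equiv i \pmod m$. Assume that every $L_i$ has at least two entries and contains a letter $a$ with $f_a\ge 2$ (the latter holds, for instance, if every letter that occurs in $y$ occurs at least twice and no $L_i$ is empty). Let $\mathfrak{C}$ be the Brauer configuration whose polygons are the multisets $L_0,\dots,L_{m-1}$, whose vertices are the letters occurring in $y$, whose multiplicity function is $\mu=1$, and in whose orientation the successor sequence of a letter $a$ lists $L_0$, then $L_1$, and so on up to $L_{m-1}$, each $L_i$ as many times in a row as $a$ occurs in it. The valency of the vertex $a$ is thus $f_a$. Let $\Lambda_{\mathfrak{C}}$ be the Brauer configuration algebra of $\mathfrak{C}$ over $k$, in the sense of Green and Schroll: the quotient $kQ/I$ of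 the path algebra of the quiver $Q$ that has one vertex for each polygon and, for each letter $a$ with $f_a\ge 2$, one arrow from each entry of the successor sequence of $a$ to the cyclically next entry. Going once around the successor sequence of $a$, starting with any of its arrows, gives the special $a$-cycles; $I$ is the two-sided ideal generated by the differences $C-C'$ of special cycles $C,C'$ starting at the same polygon, the paths $C\alpha$ where $\alpha$ is the first arrow of the special cycle $C$, and the paths $\alpha\beta$ of length two that are not subpaths of any special cycle. Then $\Lambda_{\mathfrak{C}}$ is finite dimensional and $$\dim_k \Lambda_{\mathfrak{C}} = 2m+|y|\,(|y|-1)\,\mathscr{I}(y),\qquad \mathscr{I}(y)=\sum_{a\in\mathbb{Z}/n}\frac{f_a(f_a-1)}{|y|(|y|-1)},$$ where $\mathscr{I}(y)$ is the index of coincidence of $y$. -/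

import Mathlib

/-! ### Path algebras -/

/-- A path of arbitrary length (possibly `0`) in a quiver, together with its end points. -/
structure QuiverPath (Q : Type*) [Quiver Q] where
  src : Q
  tgt : Q
  path : Quiver.Path src tgt

/-- The path algebra `kQ`: the vector space with basis the set of all paths of `Q`. -/
def PathAlgebra (k Q : Type*) [Field k] [Quiver Q] : Type _ := QuiverPath Q →₀ k

namespace PathAlgebra

variable {k Q : Type*} [Field k] [Quiver Q]

noncomputable instance : AddCommGroup (PathAlgebra k Q) :=
  inferInstanceAs (AddCommGroup (QuiverPath Q →₀ k))

noncomputable instance : Module k (PathAlgebra k Q) :=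
  inferInstanceAs (Module k (QuiverPath Q →₀ k))

/-- The basis element of `kQ` given by a path. -/
noncomputable def of (k : Type*) [Field k] (x : QuiverPath Q) : PathAlgebra k Q :=
  Finsupp.single x (1 : k)

theorem hom_ext {M : Type*} [AddCommMonoid M] [Module k M] {f g : PathAlgebra k Q →ₗ[k] M}
    (h : ∀ x, f (of k x) = g (of k x)) : f = g :=
  Finsupp.lhom_ext' fun x => LinearMap.ext_ring (h x)

/-- The product of two paths: their concatenation (read from left to right) if the first one ends
where the second one starts, and zero otherwise. -/
noncomputable def mulPath (k : Type*) [Field k] (x y : QuiverPath Q) : PathAlgebra k Q :=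
  open Classical in
  if h : x.tgt = y.src then of k ⟨x.src, y.tgt, x.path.comp (y.path.cast h.symm rfl)⟩ else 0

/-- The multiplication of `kQ`, as the bilinear extension of the product of paths. -/
noncomputable def mulHom : PathAlgebra k Q →ₗ[k] PathAlgebra k Q →ₗ[k] PathAlgebra k Q :=
  Finsupp.linearCombination k fun x : QuiverPath Q =>
    (Finsupp.linearCombination k fun y : QuiverPath Q => mulPath k x y :
      (QuiverPath Q →₀ k) →ₗ[k] PathAlgebra k Q)

noncomputable instance : Mul (PathAlgebra k Q) := ⟨fun a b => mulHom a b⟩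

theorem mul_def (a b : PathAlgebra k Q) : a * b = mulHom a b := rfl

theorem of_mul_of (x y : QuiverPath Q) : of k x * of k y = mulPath k x y := by
  have h1 : (mulHom (of k x) : PathAlgebra k Q →ₗ[k] PathAlgebra k Q) =
      (Finsupp.linearCombination k fun y : QuiverPath Q => mulPath k x y :
      (QuiverPath Q →₀ k) →ₗ[k] PathAlgebra k Q) := by
    refine (Finsupp.linearCombination_single k (1 : k) x).trans (one_smul _ _)
  rw [mul_def, h1]
  exact (Finsupp.linearCombination_single k (1 : k) y).trans (one_smul _ _)

theorem of_mul_of_comp {p q r : Q} (u : Quiver.Path p q) (v : Quiver.Path q r) :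
    of k ⟨p, q, u⟩ * of k ⟨q, r, v⟩ = of k ⟨p, r, u.comp v⟩ := by
  rw [of_mul_of, mulPath, dif_pos rfl]
  rfl

theorem of_mul_of_ne {x y : QuiverPath Q} (h : x.tgt ≠ y.src) : of k x * of k y = 0 := by
  rw [of_mul_of, mulPath, dif_neg h]

theorem of_mul_assoc (x y z : QuiverPath Q) :
    of k x * of k y * of k z = of k x * (of k y * of k z) := by
  have zm : ∀ a : PathAlgebra k Q, (0 : PathAlgebra k Q) * a = 0 := fun a => by simp [mul_def]
  have mz : ∀ a : PathAlgebra k Q, a * (0 : PathAlgebra k Q) = 0 := fun a => by simp [mul_def]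
  obtain ⟨a, b, u⟩ := x
  obtain ⟨c, d, v⟩ := y
  obtain ⟨e, f, w⟩ := z
  by_cases h : b = c
  · subst h
    by_cases h' : d = e
    · subst h'
      simp only [of_mul_of_comp, Quiver.Path.comp_assoc]
    · rw [of_mul_of_comp, of_mul_of_ne h', of_mul_of_ne h', mz]
  · by_cases h' : d = e
    · subst h'
      rw [of_mul_of_comp, of_mul_of_ne h, of_mul_of_ne h, zm]
    · rw [of_mul_of_ne h, of_mul_of_ne h', zm, mz]

theorem mul_assoc_aux (a b c : PathAlgebra k Q) : a * b * c = a * (b * c) := by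
  have key : ∀ (x y : QuiverPath Q) (c : PathAlgebra k Q),
      of k x * of k y * c = of k x * (of k y * c) := by
    intro x y c
    have h : mulHom (mulHom (of k x) (of k y)) = (mulHom (of k x)).comp (mulHom (of k y)) :=
      hom_ext fun z => of_mul_assoc x y z
    exact LinearMap.congr_fun h c
  have key2 : ∀ (x : QuiverPath Q) (b c : PathAlgebra k Q),
      of k x * b * c = of k x * (b * c) := by
    intro x b c
    have h : (mulHom.flip c).comp (mulHom (of k x)) = (mulHom (of k x)).comp (mulHom.flip c) :=
      hom_ext fun y => key x y c
    exact LinearMap.congr_fun h b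
  have h : (mulHom.flip c).comp (mulHom.flip b) = mulHom.flip (mulHom b c) :=
    hom_ext fun x => key2 x b c
  exact LinearMap.congr_fun h a

variable [Fintype Q]

/-- The unit of `kQ` is the sum of the trivial paths. -/
noncomputable instance : One (PathAlgebra k Q) := ⟨∑ p : Q, of k ⟨p, p, Quiver.Path.nil⟩⟩

theorem one_def : (1 : PathAlgebra k Q) = ∑ p : Q, of k ⟨p, p, Quiver.Path.nil⟩ := rfl

theorem one_mul_aux (a : PathAlgebra k Q) : 1 * a = a := by
  have h : mulHom (1 : PathAlgebra k Q) = LinearMap.id := by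
    refine hom_ext fun y => ?_
    obtain ⟨a, b, u⟩ := y
    rw [one_def, map_sum, LinearMap.sum_apply, Finset.sum_eq_single a]
    · rw [← mul_def, of_mul_of_comp, Quiver.Path.nil_comp, LinearMap.id_apply]
    · exact fun p _ hp => of_mul_of_ne hp
    · exact fun h => absurd (Finset.mem_univ a) h
  exact LinearMap.congr_fun h a

theorem mul_one_aux (a : PathAlgebra k Q) : a * 1 = a := by
  have h : mulHom.flip (1 : PathAlgebra k Q) = LinearMap.id := by
    refine hom_ext fun y => ?_
    obtain ⟨a, b, u⟩ := y
    rw [one_def, map_sum, LinearMap.sum_apply, Finset.sum_eq_single b]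
    · rw [LinearMap.flip_apply, ← mul_def, of_mul_of_comp, Quiver.Path.comp_nil,
        LinearMap.id_apply]
    · intro p _ hp
      rw [LinearMap.flip_apply, ← mul_def, of_mul_of_ne (Ne.symm hp)]
    · exact fun h => absurd (Finset.mem_univ b) h
  exact LinearMap.congr_fun h a

noncomputable instance : Ring (PathAlgebra k Q) :=
  { (inferInstance : AddCommGroup (PathAlgebra k Q)),
    (inferInstance : Mul (PathAlgebra k Q)),
    (inferInstance : One (PathAlgebra k Q)) with
    left_distrib := fun a b c => map_add (mulHom a) b c
    right_distrib := fun a b c => LinearMap.map_add₂ mulHom a b c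
    zero_mul := fun a => LinearMap.map_zero₂ mulHom a
    mul_zero := fun a => map_zero (mulHom a)
    mul_assoc := mul_assoc_aux
    one_mul := one_mul_aux
    mul_one := mul_one_aux }

noncomputable instance : Algebra k (PathAlgebra k Q) :=
  Algebra.ofModule (fun r a b => LinearMap.map_smul₂ mulHom r a b)
    (fun r a b => map_smul (mulHom a) r b)

end PathAlgebra

/-! ### Brauer configurations and their algebras -/

/-- A Brauer configuration with polygons indexed by the finite set `P`. The vertices are the
elements of `V` that lie in at least one polygon; values attached to other elements of `V` play no
role. -/
structure BrauerConfiguration (V P : Type*) [DecidableEq V] [DecidableEq P] [Fintype P] where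
  /-- The polygons, as multisets of vertices. -/
  polygon : P → Multiset V
  /-- The multiplicity function. -/
  mu : V → ℕ
  /-- The orientation: the successor sequence of `α` lists the polygons containing `α`, each one as
  often as `α` occurs in it; it is read cyclically. -/
  succSeq : V → List P
  mu_pos : ∀ α, 0 < mu α
  count_succSeq : ∀ α p, (succSeq α).count p = (polygon p).count α
  two_le_card : ∀ p, 2 ≤ (polygon p).card
  /-- Every polygon has a non-truncated vertex. -/
  exists_nontruncated : ∀ p, ∃ α ∈ polygon p, 1 < mu α * ∑ q, (polygon q).count α

namespace BrauerConfiguration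

variable {V P : Type*} [DecidableEq V] [DecidableEq P] [Fintype P]
variable (Γ : BrauerConfiguration V P)

/-- The valency of a vertex. -/
def val (α : V) : ℕ := ∑ p, (Γ.polygon p).count α

/-- The arrows of the Brauer quiver. For each non-truncated vertex `α`, every entry of the successor
sequence of `α` is the source of one arrow, whose target is the cyclically next entry. -/
structure Arrow where
  vertex : V
  nontruncated : 1 < Γ.mu vertex * Γ.val vertex
  idx : Fin (Γ.succSeq vertex).length

variable {Γ}

/-- The arrow that starts at the next entry of the same cyclic successor sequence. -/
def Arrow.next (a : Γ.Arrow) : Γ.Arrow :=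
  ⟨a.vertex, a.nontruncated, ⟨(a.idx + 1) % (Γ.succSeq a.vertex).length,
    Nat.mod_lt _ (Nat.zero_lt_of_lt a.idx.2)⟩⟩

def Arrow.source (a : Γ.Arrow) : P := (Γ.succSeq a.vertex).get a.idx

def Arrow.target (a : Γ.Arrow) : P := a.next.source

variable (Γ)

/-- The vertex set of the Brauer quiver: one vertex for each polygon. -/
def QuiverVertex (_Γ : BrauerConfiguration V P) : Type _ := P

instance : Fintype Γ.QuiverVertex := inferInstanceAs (Fintype P)

/-- The Brauer quiver. -/
instance : Quiver Γ.QuiverVertex where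
  Hom p q := {a : Γ.Arrow // a.source = p ∧ a.target = q}

variable {Γ}
variable (k : Type*) [Field k]

/-- An arrow as an element of the path algebra of the Brauer quiver. -/
noncomputable def Arrow.elem (a : Γ.Arrow) : PathAlgebra k Γ.QuiverVertex :=
  PathAlgebra.of k
    ⟨a.source, a.target, Quiver.Hom.toPath (V := Γ.QuiverVertex) ⟨a, rfl, rfl⟩⟩

/-- The special cycle that starts with the arrow `a`: the path that runs once around the cyclic
successor sequence of the vertex of `a`. The special `α`-cycles at a polygon `p` are those given by
the arrows of `α` with source `p`. -/
noncomputable def Arrow.specialCycle (a : Γ.Arrow) : PathAlgebra k Γ.QuiverVertex :=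
  ((List.iterate Arrow.next a (Γ.val a.vertex)).map (Arrow.elem k)).prod

variable (Γ)

/-- The relations of the Brauer configuration algebra:
* `C ^ μ(α) - D ^ μ(β)` for special cycles `C`, `D` of vertices `α`, `β` at the same polygon;
* `C ^ μ(α) * a` where `a` is the first arrow of the special `α`-cycle `C`;
* `a * b` for composable arrows such that `b` does not follow `a` in a special cycle (run through
  repeatedly, so that the square of the loop at a vertex of valency one is not a relation). -/
inductive Relation : PathAlgebra k Γ.QuiverVertex → Prop
  | cycle_sub_cycle (a b : Γ.Arrow) (h : a.source = b.source) :
      Relation (a.specialCycle k ^ Γ.mu a.vertex - b.specialCycle k ^ Γ.mu b.vertex)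
  | cycle_mul_first (a : Γ.Arrow) :
      Relation (a.specialCycle k ^ Γ.mu a.vertex * a.elem k)
  | arrow_mul_arrow (a b : Γ.Arrow) (h : a.target = b.source) (hab : b ≠ a.next) :
      Relation (a.elem k * b.elem k)

/-- The two-sided ideal generated by the relations. -/
noncomputable def relationIdeal : Ideal (PathAlgebra k Γ.QuiverVertex) :=
  (TwoSidedIdeal.span {x | Γ.Relation k x}).asIdeal

instance : (Γ.relationIdeal k).IsTwoSided :=
  inferInstanceAs (TwoSidedIdeal.span {x | Γ.Relation k x}).asIdeal.IsTwoSided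

/-- The Brauer configuration algebra. -/
abbrev BrauerAlgebra : Type _ := PathAlgebra k Γ.QuiverVertex ⧸ Γ.relationIdeal k

end BrauerConfiguration

/-! ### The Vigenère cryptosystem -/

namespace Vigenere

/-- Vigenère encryption over the alphabet `ℤ/n` with the key `K` of length `m`: the letter in
position `j` (counted from `0`) is shifted by the key letter with index `j mod m`. -/
def encrypt {n m : ℕ} [NeZero m] (K : Fin m → ZMod n) (x : List (ZMod n)) : List (ZMod n) :=
  x.mapIdx fun j c => c + K (Fin.ofNat m j)

/-- The `i`-th of the `m` lists into which a text is split: its letters in the positions congruent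
to `i` modulo `m`. -/
def sublist {n : ℕ} (m : ℕ) (y : List (ZMod n)) (i : Fin m) : List (ZMod n) :=
  (y.zipIdx.filter fun c => c.2 % m = i).map Prod.fst

/-- The index of coincidence of a text. -/
def indexOfCoincidence {n : ℕ} [NeZero n] (y : List (ZMod n)) : ℚ :=
  ∑ a : ZMod n, ((y.count a : ℚ) * (y.count a - 1)) / ((y.length : ℚ) * (y.length - 1))

theorem sum_count_sublist {n : ℕ} (m : ℕ) [NeZero m] (y : List (ZMod n)) (a : ZMod n) :
    ∑ i : Fin m, (sublist m y i).count a = y.count a := by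
  have aux : ∀ l : List (ZMod n × ℕ),
      ∑ i : Fin m, ((l.filter fun c => c.2 % m = i).map Prod.fst).count a =
        (l.map Prod.fst).count a := by
    intro l
    induction l with
    | nil => simp
    | cons c l ih =>
      have hsum : ∀ i : Fin m,
          (((c :: l).filter fun c => c.2 % m = i).map Prod.fst).count a =
            ((l.filter fun c => c.2 % m = i).map Prod.fst).count a +
              if i = Fin.ofNat m c.2 then (if c.1 = a then 1 else 0) else 0 := by
        intro i
        by_cases h : c.2 % m = i
        · have h' : i = Fin.ofNat m c.2 := Fin.ext (by simp [h])
          rw [List.filter_cons_of_pos (by simpa using h), if_pos h', List.map_cons,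
            List.count_cons]
          simp
        · have h' : ¬ i = Fin.ofNat m c.2 := fun e => h (by simp [e])
          rw [List.filter_cons_of_neg (by simpa using h), if_neg h', add_zero]
      rw [Finset.sum_congr rfl fun i _ => hsum i, Finset.sum_add_distrib, ih, List.map_cons,
        List.count_cons]
      simp
  simpa [sublist] using aux y.zipIdx

/-- The Brauer configuration of a text `y` split into `m` lists: the polygons are these lists, the
vertices are the letters of `y`, all multiplicities are `1`, and the first list precedes the second
one, and so on, in all successor sequences. -/
def configuration {n : ℕ} (m : ℕ) [NeZero m] (y : List (ZMod n))
    (hcard : ∀ i : Fin m, 2 ≤ (sublist m y i).length)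
    (hfreq : ∀ i : Fin m, ∃ a ∈ sublist m y i, 1 < y.count a) :
    BrauerConfiguration (ZMod n) (Fin m) where
  polygon i := (sublist m y i : Multiset (ZMod n))
  mu _ := 1
  succSeq a := (List.finRange m).flatMap fun i => List.replicate ((sublist m y i).count a) i
  mu_pos _ := one_pos
  count_succSeq a p := by
    rw [List.count_flatMap, Multiset.coe_count]
    have : (List.count p ∘ fun i => List.replicate ((sublist m y i).count a) i) =
        fun i => if i = p then (sublist m y i).count a else 0 := by
      funext i
      simp [List.count_replicate]
    rw [this, ← List.ofFn_eq_map, List.sum_ofFn]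
    simp
  two_le_card i := by simpa using hcard i
  exists_nontruncated i := by
    obtain ⟨a, ha, h⟩ := hfreq i
    refine ⟨a, by simpa using ha, ?_⟩
    simpa [sum_count_sublist] using h

end Vigenere

/-! A path of the Brauer quiver that is not a run around one successor sequence vanishes in the
algebra, and so does every run longer than `C ^ μ(α)`. The surviving paths are the trivial ones, the
runs shorter than `C ^ μ(α)`, and the paths `C ^ μ(α)`, which depend only on their polygon. They are
linearly independent since the coordinates read off from these rules vanish on the relation ideal.
This leaves two basis elements for each polygon and `μ(α) val(α) - 1` for each of the `val(α)`
arrows of a non-truncated vertex `α`. -/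

namespace QuiverPath

variable {Q : Type*} [Quiver Q]

/-- The concatenation of composable paths; that the end points match is a propositional equality. -/
abbrev comp (x y : QuiverPath Q) (h : x.tgt = y.src) : QuiverPath Q :=
  ⟨x.src, y.tgt, x.path.comp (y.path.cast h.symm rfl)⟩

end QuiverPath

namespace PathAlgebra

variable {k Q : Type*} [Field k] [Quiver Q]

theorem of_mul_of_eq_of_comp {x y : QuiverPath Q} (h : x.tgt = y.src) :
    of k x * of k y = of k (x.comp y h) := by
  rw [of_mul_of, mulPath, dif_pos h, QuiverPath.comp]

variable {M : Type*} [AddCommGroup M] [Module k M]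

theorem map_mul_mul_eq_zero (f : PathAlgebra k Q →ₗ[k] M) {z : PathAlgebra k Q}
    (h : ∀ x y, f (of k x * z * of k y) = 0) (u v : PathAlgebra k Q) : f (u * z * v) = 0 := by
  have map_of_mul_mul (x : QuiverPath Q) : f ∘ₗ mulHom (of k x * z) = 0 := hom_ext (h x)
  have map_mul_mul : f ∘ₗ mulHom.flip v ∘ₗ mulHom.flip z = 0 :=
    hom_ext fun x => LinearMap.congr_fun (map_of_mul_mul x) v
  exact LinearMap.congr_fun map_mul_mul u

theorem map_eq_zero_of_mem_span [Fintype Q] (f : PathAlgebra k Q →ₗ[k] M)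
    {S : Set (PathAlgebra k Q)}
    (h : ∀ s ∈ S, ∀ x y, f (of k x * s * of k y) = 0) {z : PathAlgebra k Q}
    (hz : z ∈ TwoSidedIdeal.span S) : f z = 0 := by
  rw [TwoSidedIdeal.mem_span_iff_mem_addSubgroup_closure] at hz
  suffices AddSubgroup.closure _ ≤ f.toAddMonoidHom.ker from this hz
  rw [AddSubgroup.closure_le]
  rintro _ ⟨_, ⟨u, -, s, hs, rfl⟩, v, -, rfl⟩
  exact map_mul_mul_eq_zero f (h s hs) u v

end PathAlgebra

theorem isChain_cons_iff_eq_iterate {α : Type*} {f : α → α} {a : α} {s : List α} :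
    (a :: s).IsChain (fun b c => c = f b) ↔ a :: s = List.iterate f a (s.length + 1) := by
  induction s generalizing a with
  | nil => simp [List.iterate]
  | cons b s ih =>
    change _ ↔ a :: b :: s = a :: List.iterate f (f a) (s.length + 1)
    rw [List.isChain_cons_cons, ih, List.cons_inj_right]
    constructor
    · rintro ⟨rfl, h⟩
      exact h
    · intro h
      obtain rfl : b = f a := (List.cons.inj h).1
      exact ⟨rfl, h⟩

theorem exists_append_of_not_isChain {α : Type*} {R : α → α → Prop} {s : List α}
    (hs : ¬ s.IsChain R) : ∃ t a b u, s = t ++ a :: b :: u ∧ ¬ R a b := by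
  obtain ⟨i, hi, h⟩ := List.exists_not_getElem_of_not_isChain hs
  refine ⟨s.take i, s[i], s[i + 1], s.drop (i + 2), ?_, h⟩
  simp

namespace BrauerConfiguration

variable {V P : Type*} [DecidableEq V] [DecidableEq P] [Fintype P]
variable {Γ : BrauerConfiguration V P}

theorem mem_succSeq_iff {α : V} {p : P} : p ∈ Γ.succSeq α ↔ α ∈ Γ.polygon p := by
  rw [← List.count_pos_iff, Γ.count_succSeq, Multiset.count_pos]

theorem length_succSeq (α : V) : (Γ.succSeq α).length = Γ.val α := by
  simp only [val, ← Γ.count_succSeq, ← Multiset.coe_count]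
  rw [Multiset.sum_count_eq_card fun p _ => Finset.mem_univ p, Multiset.coe_card]

/-- The source of an arrow, as a vertex of the Brauer quiver. -/
def Arrow.src (a : Γ.Arrow) : Γ.QuiverVertex := a.source

/-- The target of an arrow, as a vertex of the Brauer quiver. -/
def Arrow.tgt (a : Γ.Arrow) : Γ.QuiverVertex := a.target

theorem exists_arrow_src_eq (p : Γ.QuiverVertex) : ∃ a : Γ.Arrow, a.src = p := by
  obtain ⟨α, hα, h⟩ := Γ.exists_nontruncated p
  obtain ⟨i, hi⟩ := List.get_of_mem (mem_succSeq_iff.2 hα)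
  exact ⟨⟨α, h, i⟩, hi⟩

namespace Arrow

/-- The length of the path `C ^ μ(α)`, where `C` is a special cycle of the vertex `α` of `a`. -/
def cycleLength (a : Γ.Arrow) : ℕ := Γ.mu a.vertex * Γ.val a.vertex

theorem one_lt_cycleLength (a : Γ.Arrow) : 1 < a.cycleLength := a.nontruncated

theorem cycleLength_pos (a : Γ.Arrow) : 0 < a.cycleLength := zero_lt_one.trans a.one_lt_cycleLength

theorem next_iterate (a : Γ.Arrow) (j : ℕ) :
    next^[j] a = ⟨a.vertex, a.nontruncated, ⟨(a.idx + j) % (Γ.succSeq a.vertex).length,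
      Nat.mod_lt _ (Nat.zero_lt_of_lt a.idx.2)⟩⟩ := by
  induction j with
  | zero =>
    obtain ⟨α, h, i, hi⟩ := a
    simp [Nat.mod_eq_of_lt hi]
  | succ j ih =>
    rw [Function.iterate_succ_apply', ih]
    simp [next, add_assoc]

theorem cycleLength_next_iterate (a : Γ.Arrow) (j : ℕ) :
    (next^[j] a).cycleLength = a.cycleLength := by
  rw [next_iterate, cycleLength, cycleLength]

theorem next_iterate_mul_val (a : Γ.Arrow) (j : ℕ) : next^[j * Γ.val a.vertex] a = a := by
  obtain ⟨α, h, i, hi⟩ := a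
  simp [next_iterate, ← length_succSeq, Nat.mod_eq_of_lt hi]

theorem next_iterate_cycleLength (a : Γ.Arrow) : next^[a.cycleLength] a = a :=
  a.next_iterate_mul_val _

theorem mem_iterate_cycleLength (a : Γ.Arrow) : a ∈ List.iterate next a a.cycleLength :=
  List.mem_iterate.2 ⟨0, a.cycleLength_pos, rfl⟩

end Arrow

/-- A list of arrows is special if each entry is followed by its successor, that is, if the list
runs around a single successor sequence, possibly several times. -/
def IsSpecial (s : List Γ.Arrow) : Prop := s.IsChain fun a b => b = a.next

theorem isSpecial_cons_iff {a : Γ.Arrow} {s : List Γ.Arrow} :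
    IsSpecial (a :: s) ↔ a :: s = List.iterate Arrow.next a (s.length + 1) :=
  isChain_cons_iff_eq_iterate

theorem IsSpecial.cycleLength_eq {a b : Γ.Arrow} {s : List Γ.Arrow} (hs : IsSpecial (a :: s))
    (hb : b ∈ a :: s) : b.cycleLength = a.cycleLength := by
  rw [isSpecial_cons_iff.1 hs] at hb
  obtain ⟨j, -, rfl⟩ := List.mem_iterate.1 hb
  exact a.cycleLength_next_iterate j

/-- The arrows of a path in the Brauer quiver, in the order in which the path runs through them. -/
def arrows {p : Γ.QuiverVertex} : ∀ {q : Γ.QuiverVertex}, Quiver.Path p q → List Γ.Arrow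
  | _, .nil => []
  | _, .cons u e => arrows u ++ [e.1]

@[simp]
theorem arrows_nil (p : Γ.QuiverVertex) : arrows (Quiver.Path.nil : Quiver.Path p p) = [] := rfl

@[simp]
theorem arrows_cons {p q r : Γ.QuiverVertex} (u : Quiver.Path p q) (e : q ⟶ r) :
    arrows (u.cons e) = arrows u ++ [e.1] := rfl

theorem arrows_comp {x y : QuiverPath Γ.QuiverVertex} (h : x.tgt = y.src) :
    arrows (x.comp y h).path = arrows x.path ++ arrows y.path := by
  obtain ⟨p, q, u⟩ := x
  obtain ⟨q, r, v⟩ := y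
  obtain rfl : _ = q := h
  change arrows (u.comp v) = arrows u ++ arrows v
  induction v with
  | nil => simp
  | cons v e ih => simp [ih]

namespace Arrow

/-- The path that consists of a single arrow. -/
def toQuiverPath (a : Γ.Arrow) : QuiverPath Γ.QuiverVertex :=
  ⟨a.src, a.tgt, Quiver.Hom.toPath ⟨a, rfl, rfl⟩⟩

theorem arrows_toQuiverPath (a : Γ.Arrow) : arrows a.toQuiverPath.path = [a] := rfl

/-- The path of length `l` that starts with the arrow `a` and runs around the successor sequence of
its vertex. -/
def walk (a : Γ.Arrow) : ∀ l : ℕ, Quiver.Path a.src (next^[l] a).src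
  | 0 => .nil
  | l + 1 => (a.walk l).cons
      ⟨next^[l] a, rfl, congrArg source (Function.iterate_succ_apply' next l a).symm⟩

theorem arrows_walk (a : Γ.Arrow) (l : ℕ) : arrows (a.walk l) = List.iterate next a l := by
  induction l with
  | zero => rfl
  | succ l ih => rw [walk, arrows_cons, ih, List.iterate_add]; rfl

/-- The path `C ^ μ(α)`, where `C` is the special cycle that starts with the arrow `a` of `α`. -/
def cyclePath (a : Γ.Arrow) : QuiverPath Γ.QuiverVertex :=
  ⟨a.src, (next^[a.cycleLength] a).src, a.walk a.cycleLength⟩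

theorem cyclePath_src (a : Γ.Arrow) : a.cyclePath.src = a.src := rfl

theorem cyclePath_tgt (a : Γ.Arrow) : a.cyclePath.tgt = a.src :=
  congrArg src a.next_iterate_cycleLength

theorem arrows_cyclePath (a : Γ.Arrow) :
    arrows a.cyclePath.path = List.iterate next a a.cycleLength :=
  a.arrows_walk _

end Arrow

variable (k : Type*) [Field k]

theorem of_cons {p q r : Γ.QuiverVertex} (u : Quiver.Path p q) (e : q ⟶ r) :
    PathAlgebra.of k ⟨p, r, u.cons e⟩ = PathAlgebra.of k ⟨p, q, u⟩ * Arrow.elem k e.1 := by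
  obtain ⟨a, h, h'⟩ := e
  change a.src = q at h
  change a.tgt = r at h'
  subst h h'
  exact (PathAlgebra.of_mul_of_comp u (Quiver.Hom.toPath ⟨a, rfl, rfl⟩)).symm

theorem of_eq_prod_elem {p q : Γ.QuiverVertex} (u : Quiver.Path p q) (hu : arrows u ≠ []) :
    PathAlgebra.of k ⟨p, q, u⟩ = ((arrows u).map (Arrow.elem k)).prod := by
  induction u with
  | nil => exact absurd rfl hu
  | cons u e ih =>
    cases u with
    | nil =>
      obtain ⟨a, h, h'⟩ := e
      change a.src = _ at h
      change a.tgt = _ at h'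
      subst h h'
      simp only [arrows_cons, arrows_nil, List.nil_append, List.map_singleton, List.prod_singleton]
      rfl
    | cons u f => rw [of_cons, ih (by simp), arrows_cons _ e, List.map_append, List.prod_append,
        List.map_singleton, List.prod_singleton]

namespace Arrow

theorem elem_eq_of (a : Γ.Arrow) : a.elem k = PathAlgebra.of k a.toQuiverPath := rfl

theorem of_walk (a : Γ.Arrow) {l : ℕ} (hl : 0 < l) :
    PathAlgebra.of k ⟨_, _, a.walk l⟩ = ((List.iterate next a l).map (elem k)).prod := by
  rw [of_eq_prod_elem, a.arrows_walk]
  rw [a.arrows_walk, Ne, List.iterate_eq_nil]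
  exact hl.ne'

theorem specialCycle_pow (a : Γ.Arrow) (j : ℕ) :
    a.specialCycle k ^ j =
      ((List.iterate next a (j * Γ.val a.vertex)).map (elem k)).prod := by
  induction j with
  | zero => simp [List.iterate]
  | succ j ih =>
    rw [pow_succ, ih, add_mul, one_mul, List.iterate_add, List.map_append, List.prod_append,
      a.next_iterate_mul_val, specialCycle]

theorem specialCycle_pow_mu (a : Γ.Arrow) :
    a.specialCycle k ^ Γ.mu a.vertex = PathAlgebra.of k a.cyclePath := by
  rw [specialCycle_pow, cyclePath, of_walk k a a.cycleLength_pos, cycleLength]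

end Arrow

variable (Γ) in
/-- Labels for a basis of the Brauer configuration algebra. -/
inductive BasisIndex
  /-- The trivial path at a polygon. -/
  | trivial (p : Γ.QuiverVertex)
  /-- The common value of the paths `C ^ μ(α)` at a polygon. -/
  | socle (p : Γ.QuiverVertex)
  /-- The path of length `l` that starts with `a` and is a proper part of `C ^ μ(α)`. -/
  | special (a : Γ.Arrow) (l : Finset.Ioo 0 a.cycleLength)

open Classical in
/-- The coordinates of the class of a path with the given source and list of arrows. The source is
needed only for the trivial path. -/
noncomputable def coord (p : Γ.QuiverVertex) : List Γ.Arrow → Γ.BasisIndex →₀ k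
  | [] => Finsupp.single (.trivial p) 1
  | a :: s =>
    if IsSpecial (a :: s) then
      if h : s.length + 1 < a.cycleLength then
        Finsupp.single (.special a ⟨s.length + 1, Finset.mem_Ioo.2 ⟨s.length.succ_pos, h⟩⟩) 1
      else if s.length + 1 = a.cycleLength then Finsupp.single (.socle a.src) 1
      else 0
    else 0

theorem coord_of_not_isSpecial (p : Γ.QuiverVertex) {s : List Γ.Arrow} (hs : ¬ IsSpecial s) :
    coord k p s = 0 := by
  cases s with
  | nil => exact absurd List.isChain_nil hs
  | cons a s => rw [coord, if_neg hs]

theorem coord_iterate_of_mem_Ioo (p : Γ.QuiverVertex) (a : Γ.Arrow)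
    (l : Finset.Ioo 0 a.cycleLength) :
    coord k p (List.iterate Arrow.next a l) = Finsupp.single (.special a l) 1 := by
  obtain ⟨_ | l, hl⟩ := l
  · simp at hl
  · have hspecial : IsSpecial (a :: List.iterate Arrow.next a.next l) := by
      rw [isSpecial_cons_iff, List.length_iterate, List.iterate]
    simp only [List.iterate, coord, if_pos hspecial, List.length_iterate,
      dif_pos (Finset.mem_Ioo.1 hl).2]

theorem coord_iterate_cycleLength (p : Γ.QuiverVertex) (a : Γ.Arrow) :
    coord k p (List.iterate Arrow.next a a.cycleLength) = Finsupp.single (.socle a.src) 1 := by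
  obtain ⟨l, hl⟩ := Nat.exists_eq_succ_of_ne_zero a.cycleLength_pos.ne'
  have hspecial : IsSpecial (a :: List.iterate Arrow.next a.next l) := by
    rw [isSpecial_cons_iff, List.length_iterate, List.iterate]
  simp [hl, List.iterate, coord, hspecial]

theorem coord_of_cycleLength_lt (p : Γ.QuiverVertex) {s : List Γ.Arrow} {a : Γ.Arrow} (ha : a ∈ s)
    (h : a.cycleLength < s.length) : coord k p s = 0 := by
  by_cases hs : IsSpecial s
  · cases s with
    | nil => exact absurd ha List.not_mem_nil
    | cons b s =>
      rw [hs.cycleLength_eq ha, List.length_cons] at h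
      rw [coord, if_pos hs, dif_neg h.not_gt, if_neg h.ne']
  · exact coord_of_not_isSpecial k p hs

theorem coord_append_cycle_append (p : Γ.QuiverVertex) (a : Γ.Arrow) (s t : List Γ.Arrow) :
    coord k p (s ++ List.iterate Arrow.next a a.cycleLength ++ t) =
      open Classical in if s = [] ∧ t = [] then Finsupp.single (.socle a.src) 1 else 0 := by
  split_ifs with h
  · rw [h.1, h.2, List.nil_append, List.append_nil, coord_iterate_cycleLength]
  · refine coord_of_cycleLength_lt k p (a := a) (by simp [a.mem_iterate_cycleLength]) ?_
    have : 0 < s.length ∨ 0 < t.length := by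
      simpa only [List.length_pos_iff, not_and_or] using h
    simp only [List.length_append, List.length_iterate]
    lia

variable (Γ) in
/-- The linear map that sends a path to its coordinates. -/
noncomputable def coordHom : PathAlgebra k Γ.QuiverVertex →ₗ[k] Γ.BasisIndex →₀ k :=
  Finsupp.linearCombination k fun x : QuiverPath Γ.QuiverVertex => coord k x.src (arrows x.path)

theorem coordHom_of (x : QuiverPath Γ.QuiverVertex) :
    coordHom Γ k (PathAlgebra.of k x) = coord k x.src (arrows x.path) :=
  (Finsupp.linearCombination_single k (1 : k) x).trans (one_smul _ _)

theorem coordHom_of_mul_of_mul_of (x w y : QuiverPath Γ.QuiverVertex) :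
    coordHom Γ k (PathAlgebra.of k x * PathAlgebra.of k w * PathAlgebra.of k y) =
      open Classical in
      if x.tgt = w.src ∧ w.tgt = y.src then
        coord k x.src (arrows x.path ++ arrows w.path ++ arrows y.path)
      else 0 := by
  split_ifs with h
  · rw [PathAlgebra.of_mul_of_eq_of_comp h.1,
      PathAlgebra.of_mul_of_eq_of_comp (x := x.comp w h.1) h.2, coordHom_of, arrows_comp,
      arrows_comp]
  · rcases not_and_or.1 h with h | h
    · rw [PathAlgebra.of_mul_of_ne h, zero_mul, map_zero]
    · rw [mul_assoc, PathAlgebra.of_mul_of_ne h, mul_zero, map_zero]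

theorem coordHom_of_mul_of_mul_of_eq_zero (x w y : QuiverPath Γ.QuiverVertex)
    (h : coord k x.src (arrows x.path ++ arrows w.path ++ arrows y.path) = 0) :
    coordHom Γ k (PathAlgebra.of k x * PathAlgebra.of k w * PathAlgebra.of k y) = 0 := by
  rw [coordHom_of_mul_of_mul_of, h, ite_self]

theorem coordHom_of_mul_relation_mul_of {z : PathAlgebra k Γ.QuiverVertex} (hz : Γ.Relation k z)
    (x y : QuiverPath Γ.QuiverVertex) :
    coordHom Γ k (PathAlgebra.of k x * z * PathAlgebra.of k y) = 0 := by
  cases hz with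
  | cycle_sub_cycle a b h =>
    have hsrc : a.src = b.src := h
    rw [mul_sub, sub_mul, map_sub, sub_eq_zero]
    rw [a.specialCycle_pow_mu k, b.specialCycle_pow_mu k, coordHom_of_mul_of_mul_of,
      coordHom_of_mul_of_mul_of, a.arrows_cyclePath, b.arrows_cyclePath, a.cyclePath_tgt,
      b.cyclePath_tgt, a.cyclePath_src, b.cyclePath_src, coord_append_cycle_append,
      coord_append_cycle_append, hsrc]
  | cycle_mul_first a =>
    have hcomp : a.cyclePath.tgt = a.toQuiverPath.src := a.cyclePath_tgt
    rw [a.specialCycle_pow_mu k, a.elem_eq_of k, PathAlgebra.of_mul_of_eq_of_comp hcomp]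
    apply coordHom_of_mul_of_mul_of_eq_zero
    rw [arrows_comp, a.arrows_toQuiverPath, a.arrows_cyclePath, ← List.append_assoc,
      List.append_assoc, coord_append_cycle_append, if_neg (by simp)]
  | arrow_mul_arrow a b h hab =>
    have hcomp : a.toQuiverPath.tgt = b.toQuiverPath.src := h
    rw [a.elem_eq_of k, b.elem_eq_of k, PathAlgebra.of_mul_of_eq_of_comp hcomp]
    apply coordHom_of_mul_of_mul_of_eq_zero
    refine coord_of_not_isSpecial k _ fun hs => hab ?_
    have harrows : arrows (a.toQuiverPath.comp b.toQuiverPath hcomp).path = [a, b] :=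
      arrows_comp hcomp
    rw [harrows] at hs
    simpa only [List.isChain_pair] using hs.left_of_append.right_of_append

theorem coordHom_of_mem_relationIdeal {z : PathAlgebra k Γ.QuiverVertex}
    (hz : z ∈ Γ.relationIdeal k) : coordHom Γ k z = 0 :=
  PathAlgebra.map_eq_zero_of_mem_span _ (fun _ => coordHom_of_mul_relation_mul_of k)
    (TwoSidedIdeal.mem_asIdeal.1 hz)

variable (Γ) in
/-- The projection of the path algebra onto the Brauer configuration algebra. -/
noncomputable def toBrauerAlgebra : PathAlgebra k Γ.QuiverVertex →ₐ[k] Γ.BrauerAlgebra k :=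
  Ideal.Quotient.mkₐ k (Γ.relationIdeal k)

theorem toBrauerAlgebra_surjective : Function.Surjective (toBrauerAlgebra Γ k) :=
  Ideal.Quotient.mkₐ_surjective k _

theorem toBrauerAlgebra_of_relation {z : PathAlgebra k Γ.QuiverVertex} (hz : Γ.Relation k z) :
    toBrauerAlgebra Γ k z = 0 :=
  Ideal.Quotient.eq_zero_iff_mem.2 (TwoSidedIdeal.mem_asIdeal.2 (TwoSidedIdeal.subset_span hz))

theorem toBrauerAlgebra_elem_mul_elem {a b : Γ.Arrow} (h : b ≠ a.next) :
    toBrauerAlgebra Γ k (a.elem k * b.elem k) = 0 := by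
  by_cases hab : a.target = b.source
  · exact toBrauerAlgebra_of_relation k (.arrow_mul_arrow a b hab h)
  · rw [Arrow.elem, Arrow.elem, PathAlgebra.of_mul_of_ne hab, map_zero]

theorem toBrauerAlgebra_prod_of_not_isSpecial {s : List Γ.Arrow} (hs : ¬ IsSpecial s) :
    toBrauerAlgebra Γ k (s.map (Arrow.elem k)).prod = 0 := by
  obtain ⟨t, a, b, u, rfl, hab⟩ := exists_append_of_not_isChain hs
  rw [List.map_append, List.map_cons, List.map_cons, List.prod_append, List.prod_cons,
    List.prod_cons, ← mul_assoc (a.elem k), map_mul, map_mul, toBrauerAlgebra_elem_mul_elem k hab,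
    zero_mul, mul_zero]

theorem toBrauerAlgebra_prod_iterate_of_cycleLength_lt (a : Γ.Arrow) {l : ℕ}
    (h : a.cycleLength < l) :
    toBrauerAlgebra Γ k ((List.iterate Arrow.next a l).map (Arrow.elem k)).prod = 0 := by
  obtain ⟨j, rfl⟩ := Nat.exists_eq_add_of_lt h
  rw [add_assoc, List.iterate_add, List.map_append, List.prod_append, a.next_iterate_cycleLength,
    List.iterate, List.map_cons, List.prod_cons, ← mul_assoc, map_mul, Arrow.cycleLength,
    ← a.specialCycle_pow k, toBrauerAlgebra_of_relation k (.cycle_mul_first a), zero_mul]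

theorem toBrauerAlgebra_cyclePath_eq {a b : Γ.Arrow} (h : a.src = b.src) :
    toBrauerAlgebra Γ k (PathAlgebra.of k a.cyclePath) =
      toBrauerAlgebra Γ k (PathAlgebra.of k b.cyclePath) := by
  rw [← sub_eq_zero, ← map_sub, ← a.specialCycle_pow_mu k, ← b.specialCycle_pow_mu k]
  exact toBrauerAlgebra_of_relation k (.cycle_sub_cycle a b h)

/-- A path that represents the basis element with the given label. -/
noncomputable def basisPath : Γ.BasisIndex → QuiverPath Γ.QuiverVertex
  | .trivial p => ⟨p, p, Quiver.Path.nil⟩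
  | .socle p => (exists_arrow_src_eq p).choose.cyclePath
  | .special a l => ⟨_, _, a.walk l⟩

theorem coordHom_basisPath (i : Γ.BasisIndex) :
    coordHom Γ k (PathAlgebra.of k (basisPath i)) = Finsupp.single i 1 := by
  rw [coordHom_of]
  cases i with
  | trivial p => rfl
  | socle p => rw [basisPath, Arrow.arrows_cyclePath, coord_iterate_cycleLength,
      (exists_arrow_src_eq p).choose_spec]
  | special a l => rw [basisPath, Arrow.arrows_walk, coord_iterate_of_mem_Ioo]

variable (Γ) in
/-- The linear map that sends coordinates to the corresponding element of the algebra. -/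
noncomputable def ofCoord : (Γ.BasisIndex →₀ k) →ₗ[k] Γ.BrauerAlgebra k :=
  Finsupp.linearCombination k fun i => toBrauerAlgebra Γ k (PathAlgebra.of k (basisPath i))

theorem ofCoord_single (i : Γ.BasisIndex) :
    ofCoord Γ k (Finsupp.single i 1) = toBrauerAlgebra Γ k (PathAlgebra.of k (basisPath i)) := by
  rw [ofCoord, Finsupp.linearCombination_single, one_smul]

theorem ofCoord_coord_iterate (p : Γ.QuiverVertex) (a : Γ.Arrow) {l : ℕ} (hl : 0 < l) :
    ofCoord Γ k (coord k p (List.iterate Arrow.next a l)) =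
      toBrauerAlgebra Γ k ((List.iterate Arrow.next a l).map (Arrow.elem k)).prod := by
  rcases lt_trichotomy l a.cycleLength with h | rfl | h
  · rw [coord_iterate_of_mem_Ioo k p a ⟨l, Finset.mem_Ioo.2 ⟨hl, h⟩⟩, ofCoord_single, basisPath,
      a.of_walk k hl]
  · rw [coord_iterate_cycleLength, ofCoord_single, ← a.of_walk k hl]
    exact toBrauerAlgebra_cyclePath_eq k (exists_arrow_src_eq a.src).choose_spec
  · rw [toBrauerAlgebra_prod_iterate_of_cycleLength_lt k a h,
      coord_of_cycleLength_lt k p (a := a) (List.mem_iterate.2 ⟨0, hl, rfl⟩)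
        (by rwa [List.length_iterate]), map_zero]

theorem ofCoord_coordHom (z : PathAlgebra k Γ.QuiverVertex) :
    ofCoord Γ k (coordHom Γ k z) = toBrauerAlgebra Γ k z := by
  suffices h : ofCoord Γ k ∘ₗ coordHom Γ k = (toBrauerAlgebra Γ k).toLinearMap from
    LinearMap.congr_fun h z
  refine PathAlgebra.hom_ext fun ⟨p, q, u⟩ => ?_
  rw [LinearMap.comp_apply, coordHom_of, AlgHom.toLinearMap_apply]
  by_cases hu : arrows u = []
  · cases u with
    | nil => exact ofCoord_single k (.trivial p)
    | cons u e => simp at hu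
  · rw [of_eq_prod_elem k u hu]
    by_cases hs : IsSpecial (arrows u)
    · obtain ⟨a, s, has⟩ := List.exists_cons_of_ne_nil hu
      rw [has] at hs ⊢
      rw [isSpecial_cons_iff.1 hs, ofCoord_coord_iterate k p a s.length.succ_pos]
    · rw [coord_of_not_isSpecial k p hs, toBrauerAlgebra_prod_of_not_isSpecial k hs, map_zero]

variable (Γ) in
/-- The linear map that sends an element of the Brauer configuration algebra to its coordinates. -/
noncomputable def toCoord : Γ.BrauerAlgebra k →ₗ[k] Γ.BasisIndex →₀ k :=
  ((Γ.relationIdeal k).restrictScalars k).liftQ (coordHom Γ k)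
    fun _ hz => coordHom_of_mem_relationIdeal k hz

theorem toCoord_toBrauerAlgebra (z : PathAlgebra k Γ.QuiverVertex) :
    toCoord Γ k (toBrauerAlgebra Γ k z) = coordHom Γ k z := rfl

theorem toCoord_comp_ofCoord : toCoord Γ k ∘ₗ ofCoord Γ k = LinearMap.id :=
  Finsupp.lhom_ext' fun i => LinearMap.ext_ring <| by
    simp only [LinearMap.comp_apply, Finsupp.lsingle_apply, LinearMap.id_apply, ofCoord_single,
      toCoord_toBrauerAlgebra, coordHom_basisPath]

theorem ofCoord_comp_toCoord : ofCoord Γ k ∘ₗ toCoord Γ k = LinearMap.id := by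
  refine LinearMap.ext fun z => ?_
  obtain ⟨z, rfl⟩ := toBrauerAlgebra_surjective k z
  exact ofCoord_coordHom k z

variable (Γ) in
/-- The basis of the Brauer configuration algebra given by the classes of the paths `basisPath`. -/
noncomputable def basis : Module.Basis Γ.BasisIndex k (Γ.BrauerAlgebra k) :=
  .ofRepr <| .ofLinearMap (toCoord Γ k) (ofCoord Γ k) (toCoord_comp_ofCoord k)
    (ofCoord_comp_toCoord k)

variable (Γ) in
/-- The vertices of a Brauer configuration: the elements of `V` that lie in some polygon. -/
def vertices : Finset V := Finset.univ.biUnion fun p => (Γ.polygon p).toFinset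

theorem mem_vertices_iff {α : V} : α ∈ Γ.vertices ↔ 0 < Γ.val α := by
  simp [vertices, val, Finset.sum_pos_iff, Multiset.count_pos]

variable (Γ) in
/-- The vertices whose successor sequences contribute arrows to the Brauer quiver. -/
def nontruncatedVertices : Finset V := Γ.vertices.filter fun α => 1 < Γ.mu α * Γ.val α

theorem mem_nontruncatedVertices_iff {α : V} :
    α ∈ Γ.nontruncatedVertices ↔ 1 < Γ.mu α * Γ.val α := by
  rw [nontruncatedVertices, Finset.mem_filter, mem_vertices_iff, and_iff_right_iff_imp]
  exact fun h => Nat.pos_of_mul_pos_left (Nat.zero_lt_of_lt h)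

variable (Γ) in
/-- An arrow is a non-truncated vertex together with an entry of its successor sequence. -/
def arrowEquiv : Γ.Arrow ≃ Σ α : Γ.nontruncatedVertices, Fin (Γ.succSeq α).length where
  toFun a := ⟨⟨a.vertex, mem_nontruncatedVertices_iff.2 a.nontruncated⟩, a.idx⟩
  invFun x := ⟨x.1, mem_nontruncatedVertices_iff.1 x.1.2, x.2⟩

instance : Fintype Γ.Arrow := .ofEquiv _ (arrowEquiv Γ).symm

variable (Γ) in
/-- The three kinds of labels as a disjoint union. -/
def basisIndexEquiv :     
    Γ.BasisIndex ≃ Γ.QuiverVertex ⊕ Γ.QuiverVertex ⊕ Σ a : Γ.Arrow, Finset.Ioo 0 a.cycleLength where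
  toFun
    | .trivial p => .inl p
    | .socle p => .inr (.inl p)
    | .special a l => .inr (.inr ⟨a, l⟩)
  invFun
    | .inl p => .trivial p
    | .inr (.inl p) => .socle p
    | .inr (.inr ⟨a, l⟩) => .special a l
  left_inv i := by cases i <;> rfl
  right_inv i := by rcases i with p | p | ⟨a, l⟩ <;> rfl

instance : Fintype Γ.BasisIndex := .ofEquiv _ (basisIndexEquiv Γ).symm

theorem sum_cycleLength_sub_one :
    ∑ a : Γ.Arrow, (a.cycleLength - 1) =
      ∑ α ∈ Γ.vertices, Γ.val α * (Γ.mu α * Γ.val α - 1) := by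
  calc ∑ a : Γ.Arrow, (a.cycleLength - 1)
      = ∑ α : Γ.nontruncatedVertices, Γ.val α * (Γ.mu α * Γ.val α - 1) := by
        rw [← (arrowEquiv Γ).symm.sum_comp, Fintype.sum_sigma]
        simp [arrowEquiv, Arrow.cycleLength, length_succSeq]
    _ = ∑ α ∈ Γ.nontruncatedVertices, Γ.val α * (Γ.mu α * Γ.val α - 1) :=
        Γ.nontruncatedVertices.sum_coe_sort fun α => Γ.val α * (Γ.mu α * Γ.val α - 1)
    _ = ∑ α ∈ Γ.vertices, Γ.val α * (Γ.mu α * Γ.val α - 1) :=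
        Finset.sum_filter_of_ne fun α _ h =>
          Nat.lt_of_sub_pos (Nat.pos_of_ne_zero (right_ne_zero_of_mul h))

theorem card_basisIndex :
    Fintype.card Γ.BasisIndex =
      2 * Fintype.card P + ∑ α ∈ Γ.vertices, Γ.val α * (Γ.mu α * Γ.val α - 1) := by
  rw [Fintype.card_congr (basisIndexEquiv Γ), Fintype.card_sum, Fintype.card_sum,
    Fintype.card_sigma, ← sum_cycleLength_sub_one, two_mul, add_assoc]
  simp only [Fintype.card_coe, Nat.card_Ioo, Nat.sub_zero]
  rfl

theorem finite_brauerAlgebra : Module.Finite k (Γ.BrauerAlgebra k) :=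
  .of_basis (basis Γ k)

theorem finrank_brauerAlgebra :
    Module.finrank k (Γ.BrauerAlgebra k) =
      2 * Fintype.card P + ∑ α ∈ Γ.vertices, Γ.val α * (Γ.mu α * Γ.val α - 1) := by
  rw [Module.finrank_eq_card_basis (basis Γ k), card_basisIndex]

end BrauerConfiguration

namespace Vigenere

variable {n m : ℕ}

theorem length_sublist_le (y : List (ZMod n)) (i : Fin m) :
    (sublist m y i).length ≤ y.length := by
  rw [sublist, List.length_map, ← y.length_zipIdx (i := 0)]
  exact List.length_filter_le _ _

theorem length_mul_length_sub_one_mul_indexOfCoincidence [NeZero n] {y : List (ZMod n)}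
    (hy : 1 < y.length) :
    (y.length : ℚ) * (y.length - 1) * indexOfCoincidence y =
      ∑ a, (y.count a : ℚ) * (y.count a - 1) := by
  have hy' : (1 : ℚ) < y.length := by exact_mod_cast hy
  have hne : (y.length : ℚ) * (y.length - 1) ≠ 0 :=
    mul_ne_zero (by linarith) (by linarith)
  rw [indexOfCoincidence, ← Finset.sum_div, mul_div_cancel₀ _ hne]

variable [NeZero m] (y : List (ZMod n))
  (hcard : ∀ i : Fin m, 2 ≤ (sublist m y i).length)
  (hfreq : ∀ i : Fin m, ∃ a ∈ sublist m y i, 1 < y.count a)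

theorem val_configuration (a : ZMod n) : (configuration m y hcard hfreq).val a = y.count a := by
  simp only [BrauerConfiguration.val, configuration, Multiset.coe_count, sum_count_sublist]

theorem finrank_brauerAlgebra_configuration [NeZero n] (k : Type*) [Field k] :
    Module.finrank k ((configuration m y hcard hfreq).BrauerAlgebra k) =
      2 * m + ∑ a, y.count a * (y.count a - 1) := by
  have hmu (a : ZMod n) : (configuration m y hcard hfreq).mu a = 1 := rfl
  simp only [BrauerConfiguration.finrank_brauerAlgebra, Fintype.card_fin, hmu, one_mul,
    val_configuration]
  congr 1
  refine Finset.sum_subset (Finset.subset_univ _) fun a _ ha => ?_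
  rw [BrauerConfiguration.mem_vertices_iff, val_configuration, Nat.pos_iff_ne_zero, not_not] at ha
  rw [ha, zero_mul]

end Vigenere

theorem theorem3p2 (k : Type*) [Field k] (n m : ℕ) [NeZero n] [NeZero m]
    (K : Fin m → ZMod n) (x y : List (ZMod n)) (hy : y = Vigenere.encrypt K x)
    (hcard : ∀ i : Fin m, 2 ≤ (Vigenere.sublist m y i).length)
    (hfreq : ∀ i : Fin m, ∃ a ∈ Vigenere.sublist m y i, 1 < y.count a) :
    Module.Finite k ((Vigenere.configuration m y hcard hfreq).BrauerAlgebra k) ∧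
    (Module.finrank k ((Vigenere.configuration m y hcard hfreq).BrauerAlgebra k) : ℚ) =
      2 * m + y.length * (y.length - 1) * Vigenere.indexOfCoincidence y := by
  have hlength : 1 < y.length := (hcard 0).trans (Vigenere.length_sublist_le y 0)
  refine ⟨BrauerConfiguration.finite_brauerAlgebra k, ?_⟩
  rw [Vigenere.finrank_brauerAlgebra_configuration,
    Vigenere.length_mul_length_sub_one_mul_indexOfCoincidence hlength]
  have cast_mul_pred (c : ℕ) : ((c * (c - 1) : ℕ) : ℚ) = c * (c - 1) := by
    cases c <;> simp
  rw [Nat.cast_add, Nat.cast_mul, Nat.cast_ofNat, Nat.cast_sum]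
  simp only [cast_mul_pred]
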